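/- Let $E$ be a real Banach space, let $\ell^1$ be the Banach space of absolutely summable real sequences with unit vectors $e_n=\chi_{\{n\}}$, and let $T\colon\ell^1\to E$ be a continuous linear operator with $T(e_n)\neq0$ for all $n\in\mathbb{N}$. Let $m_T$ be the vector measure $m_T(A)=T(\chi_A)$, defined on the $\delta$-ring $\mathcal{P}_F(\mathbb{N})$ of finite subsets of $\mathbb{N}$. For a functional $x^*\in E^*$ let $|x^*m_T|$ be the variation of the real measure $x^*m_T=x^*\circ m_T$ on $\mathcal{P}_F(\mathbb{N})$, that is, the measure $|x^*m_T|(A)=\sup\sum_j|x^*m_T(A_j)|$ on all subsets $A$ of $\mathbb{N}$, the supremum being over finite disjoint sequences $(A_j)$ of finite subsets of $A$. For $f\in L^1(|x^*m_T|)$ and $A\subset\mathbb{N}$ put $\int_A f\,dx^*m_T=\lim_k\int_A\varphi_k\,dx^*m_T$, where $(\varphi_k)$ is any sequence of finitely supported simple functions converging to $f$ in $L^1(|x^*m_T|)$, and $\int_A\varphi\,dx^*m_T=\sum_i\alpha_i\,x^*m_T(A_i\cap A)$ for $\varphi=\sum_i\alpha_i\chi_{A_i}$ with $A_i$ finite.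 Let $\ell^1(m_T)=L^1(m_T)$ be the space of all real sequences $f$ such that (i) $f\in L^1(|x^*m_T|)$ for every $x^*\in E^*$, and (ii) for every $A\subset\mathbb{N}$ there is $x_A\in E$ with $x^*(x_A)=\int_A f\,dx^*m_T$ for every $x^*\in E^*$. For $0<r<\infty$ let $\ell^r(m_T)$ be the space of all real sequences $f$ with $|f|^r\in\ell^1(m_T)$. Then, for every $0<r<\infty$, the containment $\ell^1(m_T)\subset\ell^r(m_T)$ holds if and only if $T$ is $r$-power dominated, i.e. there exists $C>0$ such that $$\Big\Vert\sum_{j\in M}x_j^r\,T(e_j)\Big\Vert_E^{1/r}\le C\,\sup_{N\subset M}\Big\Vert\sum_{j\in N}x_j\,T(e_j)\Big\Vert_E$$ for every finite set $M\subset\mathbb{N}$ and all $(x_j)_{j\in M}\subset[0,\infty)$. -/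

import Mathlib

open Filter Topology MeasureTheory
open scoped ENNReal

noncomputable section

/-- A `δ`-ring of subsets of `Ω`: a ring of sets closed under countable intersections. -/
structure DeltaRing (Ω : Type*) where
  sets : Set (Set Ω)
  isSetRing : IsSetRing sets
  iInter_mem : ∀ A : ℕ → Set Ω, (∀ n, A n ∈ sets) → (⋂ n, A n) ∈ sets

namespace DeltaRing

variable {Ω : Type*}

/-- The `σ`-algebra `R^loc` of all sets `A` with `A ∩ B ∈ R` for every `B ∈ R`. -/
@[reducible] def loc (R : DeltaRing Ω) : MeasurableSpace Ω where
  MeasurableSet' A := ∀ B ∈ R.sets, A ∩ B ∈ R.sets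
  measurableSet_empty B _ := by simpa using R.isSetRing.empty_mem
  measurableSet_compl A hA B hB := by
    have h : Aᶜ ∩ B = B \ (A ∩ B) := by ext; simp; tauto
    rw [h]
    exact R.isSetRing.sdiff_mem hB (hA B hB)
  measurableSet_iUnion A hA B hB := by
    have h : (⋃ n, A n) ∩ B = B \ ⋂ n, (B \ (A n ∩ B)) := by
      ext x; simp; tauto
    rw [h]
    exact R.isSetRing.sdiff_mem hB
      (R.iInter_mem _ fun n => R.isSetRing.sdiff_mem hB (hA n B hB))

/-- A (countably additive) vector measure on a `δ`-ring `R`. Only the values on members of `R`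
are meaningful; the values on other sets are irrelevant. -/
structure VecMeasure (R : DeltaRing Ω) (E : Type*) [AddCommMonoid E] [TopologicalSpace E] where
  toFun : Set Ω → E
  hasSum : ∀ A : ℕ → Set Ω, (∀ n, A n ∈ R.sets) → Pairwise (fun i j => Disjoint (A i) (A j)) →
    (⋃ n, A n) ∈ R.sets → HasSum (fun n => toFun (A n)) (toFun (⋃ n, A n))

namespace VecMeasure

variable {R : DeltaRing Ω}

/-- The variation of a real measure `l` on a `δ`-ring, as a set function: the supremum of
`∑ |l(B_j)|` over the finite disjoint sequences `(B_j)` of members of `R` contained in `A`. -/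
def variationFun (l : R.VecMeasure ℝ) (A : Set Ω) : ℝ≥0∞ :=
  ⨆ (n : ℕ) (B : Fin n → Set Ω) (_ : ∀ j, B j ∈ R.sets ∧ B j ⊆ A)
    (_ : Pairwise fun i j => Disjoint (B i) (B j)), ∑ j, ‖l.toFun (B j)‖ₑ

theorem toFun_empty (l : R.VecMeasure ℝ) : l.toFun ∅ = 0 := by
  have h := l.hasSum (fun _ => ∅) (fun _ => R.isSetRing.empty_mem) (fun _ _ _ => by simp)
    (by simpa using R.isSetRing.empty_mem)
  exact (tendsto_const_nhds_iff.1 h.summable.tendsto_atTop_zero)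

theorem sum_le_variationFun (l : R.VecMeasure ℝ) {ι : Type*} [Fintype ι] {A : Set Ω}
    (B : ι → Set Ω) (hB : ∀ j, B j ∈ R.sets ∧ B j ⊆ A)
    (hd : Pairwise fun i j => Disjoint (B i) (B j)) :
    ∑ j, ‖l.toFun (B j)‖ₑ ≤ l.variationFun A := by
  let e := Fintype.equivFin ι
  rw [← e.symm.sum_comp]
  exact le_iSup₂_of_le (Fintype.card ι) (fun j => B (e.symm j))
    (le_iSup₂_of_le (fun j => hB _) (fun i j hij => hd (e.symm.injective.ne hij)) le_rfl)

theorem variationFun_le (l : R.VecMeasure ℝ) {A : Set Ω} {c : ℝ≥0∞}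
    (h : ∀ (n : ℕ) (B : Fin n → Set Ω), (∀ j, B j ∈ R.sets ∧ B j ⊆ A) →
      (Pairwise fun i j => Disjoint (B i) (B j)) → ∑ j, ‖l.toFun (B j)‖ₑ ≤ c) :
    l.variationFun A ≤ c :=
  iSup₂_le fun n B => iSup₂_le fun h1 h2 => h n B h1 h2

theorem variationFun_mono (l : R.VecMeasure ℝ) {A B : Set Ω} (h : A ⊆ B) :
    l.variationFun A ≤ l.variationFun B :=
  l.variationFun_le fun _ C hC hd =>
    l.sum_le_variationFun C (fun j => ⟨(hC j).1, (hC j).2.trans h⟩) hd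

theorem variationFun_add_le (l : R.VecMeasure ℝ) {A B : Set Ω} (h : Disjoint A B) :
    l.variationFun A + l.variationFun B ≤ l.variationFun (A ∪ B) := by
  by_cases hB : l.variationFun B = ⊤
  · have := l.variationFun_mono (Set.subset_union_right (s := A) (t := B))
    rw [hB, top_le_iff] at this
    simp [this]
  have key : ∀ (n : ℕ) (C : Fin n → Set Ω), (∀ j, C j ∈ R.sets ∧ C j ⊆ A) →
      (Pairwise fun i j => Disjoint (C i) (C j)) →
      l.variationFun B + ∑ j, ‖l.toFun (C j)‖ₑ ≤ l.variationFun (A ∪ B) := by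
    intro n C hC hCd
    by_cases hX : ∑ j, ‖l.toFun (C j)‖ₑ = ⊤
    · exfalso; simp at hX
    refine add_le_of_le_tsub_right_of_le ?_ ?_
    · exact l.sum_le_variationFun C
        (fun j => ⟨(hC j).1, (hC j).2.trans Set.subset_union_left⟩) hCd
    refine l.variationFun_le fun k D hD hDd => ?_
    refine ENNReal.le_sub_of_add_le_right hX ?_
    have := l.sum_le_variationFun (A := A ∪ B) (Sum.elim D C) ?_ ?_
    · simpa using this
    · rintro (j | j)
      · exact ⟨(hD j).1, (hD j).2.trans Set.subset_union_right⟩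
      · exact ⟨(hC j).1, (hC j).2.trans Set.subset_union_left⟩
    · rintro (i | i) (j | j) hij
      · exact hDd (by simpa using hij)
      · exact h.symm.mono (hD i).2 (hC j).2
      · exact h.mono (hC i).2 (hD j).2
      · exact hCd (by simpa using hij)
  have h2 : l.variationFun A ≤ l.variationFun (A ∪ B) - l.variationFun B :=
    l.variationFun_le fun n C hC hCd =>
      ENNReal.le_sub_of_add_le_left hB (key n C hC hCd)
  exact add_le_of_le_tsub_right_of_le (l.variationFun_mono Set.subset_union_right) h2

theorem variationFun_empty (l : R.VecMeasure ℝ) : l.variationFun ∅ = 0 := by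
  refine le_antisymm (l.variationFun_le fun n B hB _ => ?_) bot_le
  have : ∀ j, B j = ∅ := fun j => Set.subset_empty_iff.1 (hB j).2
  simp [this, toFun_empty]

theorem variationFun_iUnion (l : R.VecMeasure ℝ) (A : ℕ → Set Ω)
    (hA : ∀ n, MeasurableSet[R.loc] (A n)) (hd : Pairwise (Function.onFun Disjoint A)) :
    l.variationFun (⋃ n, A n) = ∑' n, l.variationFun (A n) := by
  apply le_antisymm
  · refine l.variationFun_le fun n B hB hBd => ?_
    have hm : ∀ i j, A i ∩ B j ∈ R.sets := fun i j => hA i _ (hB j).1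
    have h1 : ∀ j, ‖l.toFun (B j)‖ₑ ≤ ∑' i, ‖l.toFun (A i ∩ B j)‖ₑ := by
      intro j
      have hu : (⋃ i, A i ∩ B j) = B j := by
        rw [← Set.iUnion_inter, Set.inter_eq_right.2 (hB j).2]
      have hs := l.hasSum (fun i => A i ∩ B j) (fun i => hm i j)
        (fun a b hab => (hd hab).mono Set.inter_subset_left Set.inter_subset_left)
        (by rw [hu]; exact (hB j).1)
      rw [hu] at hs
      rw [← hs.tsum_eq]
      exact enorm_tsum_le_tsum_enorm
    calc ∑ j, ‖l.toFun (B j)‖ₑ ≤ ∑ j, ∑' i, ‖l.toFun (A i ∩ B j)‖ₑ :=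
          Finset.sum_le_sum fun j _ => h1 j
      _ = ∑' i, ∑ j, ‖l.toFun (A i ∩ B j)‖ₑ :=
          (Summable.tsum_finsetSum fun _ _ => ENNReal.summable).symm
      _ ≤ ∑' i, l.variationFun (A i) := ENNReal.tsum_le_tsum fun i =>
          l.sum_le_variationFun (fun j => A i ∩ B j)
            (fun j => ⟨hm i j, Set.inter_subset_left⟩)
            (fun a b hab => (hBd hab).mono Set.inter_subset_right Set.inter_subset_right)
  · have key : ∀ s : Finset ℕ,
        ∑ i ∈ s, l.variationFun (A i) ≤ l.variationFun (⋃ i ∈ s, A i) := by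
      intro s
      induction s using Finset.induction_on with
      | empty => simp
      | insert a s ha ih =>
        rw [Finset.sum_insert ha, Finset.set_biUnion_insert]
        refine (add_le_add_right ih _).trans (l.variationFun_add_le ?_)
        rw [Set.disjoint_iUnion₂_right]
        exact fun i hi => hd (fun h => ha (h ▸ hi))
    rw [ENNReal.tsum_eq_iSup_sum]
    exact iSup_le fun s => (key s).trans
      (l.variationFun_mono (Set.iUnion₂_subset fun i _ => Set.subset_iUnion A i))

/-- The variation `|l|` of a real measure on `R`, as a measure on `R^loc`. -/
def variation (l : R.VecMeasure ℝ) : @Measure Ω R.loc :=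
  @Measure.ofMeasurable Ω R.loc (fun A _ => l.variationFun A) l.variationFun_empty
    (fun A hA hd => l.variationFun_iUnion A hA hd)

/-- The integral over `A` with respect to `l` of a simple function `φ`:
`∑ y l(φ⁻¹{y} ∩ A)`, the sum running over the values `y` of `φ`. -/
def simpleIntegral (l : R.VecMeasure ℝ) (A : Set Ω) (φ : @SimpleFunc Ω R.loc ℝ) : ℝ :=
  letI : MeasurableSpace Ω := R.loc
  ∑ y ∈ φ.range, y * l.toFun (φ ⁻¹' {y} ∩ A)

/-- `v` is the integral `∫_A f dl` of `f` over `A` with respect to the real measure `l`: the limit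
of `∫_A φ_k dl` for `R`-simple functions `φ_k` (simple functions supported in a member of `R`)
which converge to `f` in `L¹(|l|)`. The limit does not depend on the sequence. -/
def HasIntegral (l : R.VecMeasure ℝ) (A : Set Ω) (f : Ω → ℝ) (v : ℝ) : Prop :=
  letI : MeasurableSpace Ω := R.loc
  ∃ φ : ℕ → SimpleFunc Ω ℝ,
    (∀ k, Function.support (φ k) ∈ R.sets) ∧
    Tendsto (fun k => ∫⁻ ω, ‖f ω - φ k ω‖ₑ ∂l.variation) atTop (𝓝 0) ∧
    Tendsto (fun k => l.simpleIntegral A (φ k)) atTop (𝓝 v)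

variable {E : Type*} [NormedAddCommGroup E] [NormedSpace ℝ E]

/-- The real measure `x* m`, for a vector measure `m` and a functional `x*` in the dual. -/
def dualComp (m : R.VecMeasure E) (x' : StrongDual ℝ E) : R.VecMeasure ℝ where
  toFun A := x' (m.toFun A)
  hasSum A hA hd hU := (m.hasSum A hA hd hU).mapL x'

/-- The space `L¹(m)` of (representatives of) integrable functions with respect to the vector
measure `m`. -/
def L1 (m : R.VecMeasure E) : Set (Ω → ℝ) :=
  letI : MeasurableSpace Ω := R.loc
  {f | Measurable f ∧
    (∀ x' : StrongDual ℝ E, Integrable f (m.dualComp x').variation) ∧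
    ∀ A, MeasurableSet A →
      ∃ xA : E, ∀ x' : StrongDual ℝ E, (m.dualComp x').HasIntegral A f (x' xA)}

/-- The space `L^p(m)`, the `p`-power of `L¹(m)`. -/
def Lpow (m : R.VecMeasure E) (p : ℝ) : Set (Ω → ℝ) :=
  {f | Measurable[R.loc] f ∧ (fun ω => |f ω| ^ p) ∈ m.L1}

end VecMeasure

/-- The `δ`-ring of all finite subsets of `ℕ`. -/
def finiteSets : DeltaRing ℕ where
  sets := {A | A.Finite}
  isSetRing :=
    { empty_mem := Set.finite_empty
      union_mem := fun _ _ hA hB => Set.Finite.union hA hB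
      sdiff_mem := fun _ _ hA _ => Set.Finite.sdiff hA }
  iInter_mem A hA := (hA 0).subset (Set.iInter_subset A 0)

end DeltaRing

/-- The Banach space `ℓ¹` of absolutely summable real sequences. -/
abbrev SeqL1 : Type := lp (fun _ : ℕ => ℝ) 1

theorem memℓp_indicator {A : Set ℕ} (hA : A.Finite) :
    Memℓp (E := fun _ : ℕ => ℝ) (A.indicator fun _ => (1 : ℝ)) 1 :=
  memℓp_gen (summable_of_hasFiniteSupport
    (hA.subset (by intro n hn; by_contra h; simp [h] at hn)))

open Classical in
/-- The characteristic function `χ_A` of a finite set `A ⊆ ℕ`, as an element of `ℓ¹`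
(with value `0` if `A` is infinite). -/
def chiL1 (A : Set ℕ) : SeqL1 :=
  if hA : A.Finite then ⟨A.indicator fun _ => (1 : ℝ), memℓp_indicator hA⟩ else 0

/-- The unit vector `e_n = χ_{n}` of `ℓ¹`. -/
def unitVec (n : ℕ) : SeqL1 := chiL1 {n}

theorem hasSum_chiL1 (A : ℕ → Set ℕ) (hd : Pairwise fun i j => Disjoint (A i) (A j))
    (hU : (⋃ n, A n).Finite) : HasSum (fun n => chiL1 (A n)) (chiL1 (⋃ n, A n)) := by
  classical
  have hA : ∀ n, (A n).Finite := fun n => hU.subset (Set.subset_iUnion A n)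
  have hI : {n | (A n).Nonempty}.Finite :=
    ((Set.finite_iUnion_iff hd).1 hU).2
  have he : chiL1 (⋃ n, A n) = ∑ n ∈ hI.toFinset, chiL1 (A n) := by
    ext k
    simp only [chiL1, hU, hA, dite_true, lp.coeFn_sum, Finset.sum_apply]
    by_cases hk : k ∈ ⋃ n, A n
    · obtain ⟨n, hn⟩ := Set.mem_iUnion.1 hk
      rw [Set.indicator_of_mem hk, Finset.sum_eq_single n, Set.indicator_of_mem hn]
      · intro b _ hb
        exact Set.indicator_of_notMem (fun h => Set.disjoint_left.1 (hd hb) h hn) _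
      · intro h
        exact absurd (by simpa using ⟨k, hn⟩) h
    · rw [Set.indicator_of_notMem hk, Finset.sum_eq_zero]
      intro n _
      exact Set.indicator_of_notMem (fun h => hk (Set.mem_iUnion.2 ⟨n, h⟩)) _
  rw [he]
  refine hasSum_sum_of_ne_finset_zero fun n hn => ?_
  have : A n = ∅ := by simpa [Set.not_nonempty_iff_eq_empty] using hn
  ext k
  simp [chiL1, this]

variable {E : Type*} [NormedAddCommGroup E] [NormedSpace ℝ E]

/-- The vector measure `m_T(A) = T(χ_A)` on the finite subsets of `ℕ` associated to a continuous
linear operator `T : ℓ¹ → E`. -/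
def opMeasure (T : SeqL1 →L[ℝ] E) : DeltaRing.finiteSets.VecMeasure E where
  toFun A := T (chiL1 A)
  hasSum A _ hd hU := (hasSum_chiL1 A hd hU).mapL T

/-- `T : ℓ¹ → E` is `r`-power dominated. -/
def IsPowerDominated (T : SeqL1 →L[ℝ] E) (r : ℝ) : Prop :=
  ∃ C : ℝ, 0 < C ∧ ∀ (M : Finset ℕ) (x : ℕ → ℝ), (∀ j ∈ M, 0 ≤ x j) →
    ‖∑ j ∈ M, (x j ^ r) • T (unitVec j)‖ ^ (1 / r) ≤
      C * M.powerset.sup' (Finset.powerset_nonempty M)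
        (fun N => ‖∑ j ∈ N, x j • T (unitVec j)‖)

end

/-! On finite subsets of `ℕ` everything reduces to atoms: `m_T({n}) = T e_n`, and the integral of
`f` against `x* m_T` over `A` is the series of `f n * x*(T e_n)` over `A`. So `f ∈ L¹(m_T)` says
that all subseries of `∑ f n • T e_n` converge weakly to vectors of `E`, which by Orlicz–Pettis
means unconditional convergence (`mem_L1_opMeasure_iff_summable`). The claim becomes: summability of
`f n • T e_n` passes to `|f n| ^ r • T e_n` exactly when `T` is `r`-power dominated.

If `T` is power dominated, the inequality on finite sets far out carries the Cauchy criterion over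
(`IsPowerDominated.summable_rpow`). If it is not, there are normalized finitely supported `y k ≥ 0`
with `‖∑ (y k n) ^ r • T e_n‖ > 4 ^ (k r)`. Then `f = ∑ 2⁻ᵏ y k` is summable against `T e_n`, but `f
≥ 2⁻ᵏ y k` makes the partial sums of `f ^ r` exceed `2 ^ (k r)` for every `k`. The norm of `E` has
no order structure; monotonicity in the coefficients is replaced by a convexity bound over subsets
(`norm_sum_smul_le_of_le`). -/

namespace DeltaRing

/-! ### Integration against real measures on the finite subsets of `ℕ`. -/

theorem measurableSet_finiteSets_loc (A : Set ℕ) : MeasurableSet[finiteSets.loc] A :=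
  fun _ hB => Set.Finite.subset hB Set.inter_subset_right

theorem measurable_finiteSets_loc {β : Type*} [MeasurableSpace β] (f : ℕ → β) :
    Measurable[finiteSets.loc] f :=
  fun _ _ => measurableSet_finiteSets_loc _

theorem measurableSingletonClass_finiteSets_loc :
    @MeasurableSingletonClass ℕ finiteSets.loc :=
  @MeasurableSingletonClass.mk ℕ finiteSets.loc fun _ => measurableSet_finiteSets_loc _

namespace VecMeasure

theorem hasSum_indicator_singleton (l : finiteSets.VecMeasure ℝ) {A : Set ℕ} (hA : A.Finite) :
    HasSum (A.indicator fun n => l.toFun {n}) (l.toFun A) := by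
  have hU : (⋃ n, A ∩ {n}) = A := by ext; simp
  have h := l.hasSum (fun n => A ∩ {n}) (fun n => hA.subset Set.inter_subset_left)
    (fun i j hij => (Set.disjoint_singleton.2 hij).mono Set.inter_subset_right
      Set.inter_subset_right) (by rw [hU]; exact hA)
  rw [hU] at h
  convert h using 1
  ext n
  by_cases hn : n ∈ A
  · rw [Set.indicator_of_mem hn, Set.inter_eq_right.2 (Set.singleton_subset_iff.2 hn)]
  · rw [Set.indicator_of_notMem hn, Set.inter_singleton_eq_empty.2 hn, l.toFun_empty]

theorem toFun_finset (l : finiteSets.VecMeasure ℝ) (s : Finset ℕ) :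
    l.toFun s = ∑ n ∈ s, l.toFun {n} := by
  refine (l.hasSum_indicator_singleton s.finite_toSet).unique ?_
  have h := hasSum_sum_of_ne_finset_zero (L := .unconditional ℕ) (f := (s : Set ℕ).indicator fun n => l.toFun {n})
    (s := s) (fun n hn => Set.indicator_of_notMem (by simpa using hn) _)
  rwa [Finset.sum_congr rfl fun n hn => Set.indicator_of_mem (Finset.mem_coe.2 hn) _] at h

theorem variation_singleton (l : finiteSets.VecMeasure ℝ) (n : ℕ) :
    l.variation {n} = ‖l.toFun {n}‖ₑ := by
  have h : l.variation {n} = l.variationFun {n} :=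
    @Measure.ofMeasurable_apply ℕ finiteSets.loc (fun A _ => l.variationFun A)
      l.variationFun_empty (fun A hA hd => l.variationFun_iUnion A hA hd) _
      (measurableSet_finiteSets_loc _)
  rw [h]
  refine le_antisymm (l.variationFun_le fun k B hB hd => ?_) ?_
  · by_cases hj : ∃ j, B j = {n}
    · obtain ⟨j, hj⟩ := hj
      rw [Finset.sum_eq_single j, hj]
      · intro i _ hij
        have h0 : B i = ∅ := by
          have h1 : Disjoint (B i) (B j) := hd hij
          rw [hj] at h1
          exact Set.subset_empty_iff.1 (h1 le_rfl (hB i).2)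
        rw [h0, l.toFun_empty, enorm_zero]
      · simp
    · rw [Finset.sum_eq_zero]
      · exact bot_le
      · intro i _
        rcases Set.subset_singleton_iff_eq.1 (hB i).2 with h0 | h0
        · rw [h0, l.toFun_empty, enorm_zero]
        · exact absurd ⟨i, h0⟩ hj
  · have := l.sum_le_variationFun (A := {n}) (fun _ : Unit => {n})
      (fun _ => ⟨Set.finite_singleton n, le_rfl⟩) (fun i j hij => absurd (Subsingleton.elim i j) hij)
    simpa using this

/-- Every subset of the countable set `ℕ` is measurable, so `|l|` is determined by its atoms. -/
theorem lintegral_variation (l : finiteSets.VecMeasure ℝ) (g : ℕ → ℝ≥0∞) :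
    @lintegral ℕ finiteSets.loc l.variation g = ∑' n, g n * ‖l.toFun {n}‖ₑ := by
  rw [@lintegral_countable' ℕ finiteSets.loc _ _ measurableSingletonClass_finiteSets_loc]
  simp only [variation_singleton]

theorem integrable_variation_iff (l : finiteSets.VecMeasure ℝ) (f : ℕ → ℝ) :
    Integrable[finiteSets.loc] f l.variation ↔ Summable fun n => f n * l.toFun {n} := by
  let := finiteSets.loc
  have h : Integrable f l.variation ↔ ∑' n, ‖f n * l.toFun {n}‖ₑ ≠ ⊤ := by
    rw [Integrable, and_iff_right (measurable_finiteSets_loc f).aestronglyMeasurable,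
      HasFiniteIntegral, lintegral_variation, lt_top_iff_ne_top]
    simp only [enorm_mul]
  rw [h, ← summable_norm_iff, ← tsum_enorm_ne_top_iff_summable_norm]

theorem simpleIntegral_eq_tsum (l : finiteSets.VecMeasure ℝ) (A : Set ℕ)
    (φ : @SimpleFunc ℕ finiteSets.loc ℝ)
    (hφ : (Function.support φ).Finite) :
    l.simpleIntegral A φ = ∑' n, A.indicator (fun n => φ n * l.toFun {n}) n := by
  classical
  let := finiteSets.loc
  have hs : ∀ n ∉ hφ.toFinset, A.indicator (fun n => φ n * l.toFun {n}) n = 0 := by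
    intro n hn
    have : φ n = 0 := by simpa using hn
    simp [Set.indicator_apply, this]
  rw [tsum_eq_sum hs]
  have hmaps : ∀ n ∈ hφ.toFinset, φ n ∈ φ.range := fun n _ => φ.mem_range_self n
  rw [← Finset.sum_fiberwise_of_maps_to hmaps]
  refine Finset.sum_congr rfl fun y _ => ?_
  -- The zero level set may be infinite, where `l.toFun` is meaningless; the factor `y = 0` removes
  -- that term.
  by_cases hy : y = 0
  · subst hy
    rw [zero_mul, Finset.sum_eq_zero]
    intro n hn
    simp [Set.indicator_apply, (Finset.mem_filter.1 hn).2]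
  · have hset : φ ⁻¹' {y} ∩ A =
        (((hφ.toFinset.filter fun n => φ n = y).filter fun n => n ∈ A : Finset ℕ) : Set ℕ) := by
      ext n
      simp only [Set.mem_inter_iff, Set.mem_preimage, Set.mem_singleton_iff, Finset.coe_filter,
        Finset.mem_filter, Set.Finite.mem_toFinset, Function.mem_support, Set.mem_ofPred_eq]
      constructor
      · rintro ⟨rfl, h⟩
        exact ⟨⟨hy, rfl⟩, h⟩
      · rintro ⟨⟨_, h1⟩, h2⟩
        exact ⟨h1, h2⟩
    rw [hset, toFun_finset, Finset.mul_sum, Finset.sum_filter]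
    refine Finset.sum_congr rfl fun n hn => ?_
    rw [Set.indicator_apply, (Finset.mem_filter.1 hn).2]

/-- Integration over `A` is 1-Lipschitz for the `L¹(|l|)` distance, so every admissible
approximating sequence gives the same limit, namely the series. -/
theorem hasIntegral_iff (l : finiteSets.VecMeasure ℝ) (A : Set ℕ) {f : ℕ → ℝ}
    (hf : Summable fun n => f n * l.toFun {n}) (v : ℝ) :
    l.HasIntegral A f v ↔ v = ∑' n, A.indicator (fun n => f n * l.toFun {n}) n := by
  classical
  let := finiteSets.loc
  have key : ∀ φ : ℕ → SimpleFunc ℕ ℝ, (∀ k, (Function.support (φ k)).Finite) →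
      Tendsto (fun k => ∫⁻ ω, ‖f ω - φ k ω‖ₑ ∂l.variation) atTop (𝓝 0) →
      Tendsto (fun k => l.simpleIntegral A (φ k)) atTop
        (𝓝 (∑' n, A.indicator (fun n => f n * l.toFun {n}) n)) := by
    intro φ hφ hlim
    rw [tendsto_iff_edist_tendsto_0]
    refine tendsto_of_tendsto_of_tendsto_of_le_of_le tendsto_const_nhds hlim (fun _ => bot_le)
      fun k => ?_
    have hφs : Summable (A.indicator (fun n => φ k n * l.toFun {n})) :=
      (summable_of_hasFiniteSupport ((hφ k).subset fun n hn h => hn (by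
        simp [h]))).indicator A
    simp only [l.simpleIntegral_eq_tsum A (φ k) (hφ k)]
    rw [edist_comm, edist_eq_enorm_sub, ← (hf.indicator A).tsum_sub hφs, lintegral_variation]
    refine enorm_tsum_le_tsum_enorm.trans (ENNReal.tsum_le_tsum fun n => ?_)
    by_cases hn : n ∈ A
    · simp only [Set.indicator_of_mem hn, ← sub_mul, enorm_mul, le_refl]
    · simp [Set.indicator_of_notMem hn]
  constructor
  · rintro ⟨φ, hφ, h1, h2⟩
    exact tendsto_nhds_unique h2 (key φ hφ h1)
  · rintro rfl
    -- Truncations of `f` to `n < k` approximate it: the error is the tail of an absolutely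
    -- convergent series.
    let φ : ℕ → SimpleFunc ℕ ℝ := fun k =>
      { toFun := fun n => if n < k then f n else 0
        measurableSet_fiber' := fun _ => measurableSet_finiteSets_loc _
        finite_range' := by
          refine (((Finset.range k).image f ∪ {0}).finite_toSet).subset ?_
          rintro _ ⟨n, rfl⟩
          by_cases hn : n < k
          · simp only [hn, if_true]
            simpa using Or.inr ⟨n, hn, rfl⟩
          · simp [hn] }
    have hφ_apply : ∀ k n, φ k n = if n < k then f n else 0 := fun _ _ => rfl
    clear_value φ
    have hφ : ∀ k, (Function.support (φ k)).Finite := fun k =>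
      (Finset.range k).finite_toSet.subset fun n hn => by
        by_contra h
        rw [Finset.mem_coe, Finset.mem_range] at h
        rw [Function.mem_support, hφ_apply, if_neg h] at hn
        exact hn rfl
    have hlim : Tendsto (fun k => ∫⁻ ω, ‖f ω - φ k ω‖ₑ ∂l.variation) atTop (𝓝 0) := by
      have htop : ∑' n, ‖f n * l.toFun {n}‖ₑ ≠ ⊤ :=
        tsum_enorm_ne_top_iff_summable_norm.2 hf.norm
      refine (ENNReal.tendsto_sum_nat_add (fun n => ‖f n * l.toFun {n}‖ₑ) htop).congr fun k => ?_
      rw [lintegral_variation, ← Summable.sum_add_tsum_nat_add' (k := k)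
        (f := fun n => ‖f n - φ k n‖ₑ * ‖l.toFun {n}‖ₑ) ENNReal.summable,
        Finset.sum_eq_zero, zero_add]
      · refine tsum_congr fun n => ?_
        have : φ k (n + k) = 0 := by rw [hφ_apply, if_neg (by omega)]
        rw [this, sub_zero, enorm_mul]
      · intro n hn
        have : φ k n = f n := by rw [hφ_apply, if_pos (by simpa using hn)]
        rw [this, sub_self, enorm_zero, zero_mul]
    exact ⟨φ, hφ, hlim, key φ hφ hlim⟩

end VecMeasure

end DeltaRing

theorem mem_L1_opMeasure_iff {E : Type*} [NormedAddCommGroup E] [NormedSpace ℝ E]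
    (T : SeqL1 →L[ℝ] E) (f : ℕ → ℝ) :
    f ∈ (opMeasure T).L1 ↔
      (∀ x' : StrongDual ℝ E, Summable fun n => x' (f n • T (unitVec n))) ∧
      ∀ A : Set ℕ, ∃ xA : E, ∀ x' : StrongDual ℝ E,
        x' xA = ∑' n, A.indicator (fun n => x' (f n • T (unitVec n))) n := by
  have hval : ∀ (x' : StrongDual ℝ E) n,
      f n * ((opMeasure T).dualComp x').toFun {n} = x' (f n • T (unitVec n)) := by
    intro x' n
    rw [map_smul]
    rfl
  have hint : ∀ x' : StrongDual ℝ E, Integrable[DeltaRing.finiteSets.loc] f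
      ((opMeasure T).dualComp x').variation ↔
      Summable fun n => x' (f n • T (unitVec n)) := by
    intro x'
    rw [DeltaRing.VecMeasure.integrable_variation_iff]
    simp only [hval]
  constructor
  · rintro ⟨-, h1, h2⟩
    have h1' := fun x' => (hint x').1 (h1 x')
    refine ⟨h1', fun A => ?_⟩
    obtain ⟨x, hx⟩ := h2 A (DeltaRing.measurableSet_finiteSets_loc A)
    refine ⟨x, fun x' => ?_⟩
    have := (DeltaRing.VecMeasure.hasIntegral_iff _ A (by simpa only [hval] using h1' x') _).1
      (hx x')
    simpa only [hval] using this
  · rintro ⟨h1, h2⟩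
    refine ⟨DeltaRing.measurable_finiteSets_loc f, fun x' => (hint x').2 (h1 x'), fun A _ => ?_⟩
    obtain ⟨x, hx⟩ := h2 A
    refine ⟨x, fun x' => ?_⟩
    refine (DeltaRing.VecMeasure.hasIntegral_iff _ A (by simpa only [hval] using h1 x') _).2 ?_
    simpa only [hval] using hx x'

/-! ### Unconditional convergence in Banach spaces. -/

section BanachSpace

variable {E : Type*} [NormedAddCommGroup E] [NormedSpace ℝ E]

/-- A vector on which every functional killing a submodule vanishes lies in its closure. -/
theorem mem_closure_of_forall_dual_eq_zero (p : Submodule ℝ E) {x : E}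
    (h : ∀ x' : StrongDual ℝ E, (∀ y ∈ p, x' y = 0) → x' x = 0) : x ∈ closure (p : Set E) := by
  by_contra hx
  obtain ⟨g, u, hgu, hux⟩ := geometric_hahn_banach_closed_point
    (s := closure (p : Set E)) p.convex.closure isClosed_closure hx
  -- A functional bounded above on a subspace vanishes there: otherwise some multiple of `y` takes
  -- the forbidden value `u`.
  have h0 : ∀ y ∈ p, g y = 0 := by
    intro y hy
    by_contra hne
    have h1 := hgu (((u / g y)) • y) (subset_closure (p.smul_mem _ hy))
    rw [map_smul, smul_eq_mul, div_mul_cancel₀ _ hne] at h1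
    exact lt_irrefl _ h1
  have h1 := hgu 0 (subset_closure p.zero_mem)
  rw [map_zero] at h1
  rw [h g h0] at hux
  exact lt_asymm h1 hux

/-- The Orlicz–Pettis theorem: a series all of whose subseries converge weakly is unconditionally
convergent. -/
theorem summable_of_weakly_subseries_summable [CompleteSpace E] {v : ℕ → E}
    (hs : ∀ x' : StrongDual ℝ E, Summable fun n => x' (v n))
    (hA : ∀ A : Set ℕ, ∃ xA : E, ∀ x' : StrongDual ℝ E,
      x' xA = ∑' n, A.indicator (fun n => x' (v n)) n) : Summable v := by
  choose w hw using hA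
  let p := Submodule.span ℝ (Set.range v)
  have hmem : ∀ A, w A ∈ closure (p : Set E) := by
    intro A
    refine mem_closure_of_forall_dual_eq_zero p fun x' hx' => ?_
    rw [hw]
    have : ∀ n, A.indicator (fun n => x' (v n)) n = 0 := fun n => by
      simp [hx' _ (Submodule.subset_span (Set.mem_range_self n))]
    simp [this]
  have hsep : TopologicalSpace.IsSeparable (closure (p : Set E)) :=
    ((Set.countable_range v).isSeparable.span (R := ℝ)).closure
  obtain ⟨D, hDc, hD⟩ := hsep
  have hDne : D.Nonempty := by
    have : (closure D).Nonempty := ⟨w ∅, hD (hmem ∅)⟩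
    exact closure_nonempty_iff.1 this
  obtain ⟨d, hd⟩ := hDc.exists_eq_range hDne
  rw [summable_iff_vanishing_norm]
  intro ε hε
  -- Subsets of `ℕ` become points of the Cantor space, a Baire space on which `W` is weakly
  -- continuous with values in a separable set.
  let W : (ℕ → Bool) → E := fun a => w {n | a n = true}
  have hWc : ∀ x' : StrongDual ℝ E, Continuous fun a => x' (W a) := by
    intro x'
    have he : (fun a => x' (W a)) = fun a : ℕ → Bool =>
        ∑' n, (fun b : Bool => if b = true then x' (v n) else 0) (a n) := by
      ext a
      rw [hw]
      refine tsum_congr fun n => ?_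
      simp [Set.indicator_apply]
    rw [he]
    refine continuous_tsum (u := fun n => ‖x' (v n)‖)
      (fun n => Continuous.comp (g := fun b : Bool => if b = true then x' (v n) else 0)
        continuous_of_discreteTopology (continuous_apply n)) (hs x').norm
      fun n a => ?_
    dsimp only
    split_ifs <;> simp
  have hclosed : ∀ i, IsClosed {a | ‖W a - d i‖ ≤ ε / 3} := by
    intro i
    -- Norm balls are intersections of weakly closed sets, so weak continuity of `W` suffices.
    have he : {a | ‖W a - d i‖ ≤ ε / 3} =
        ⋂ x' : StrongDual ℝ E, {a | ‖x' (W a) - x' (d i)‖ ≤ ε / 3 * ‖x'‖} := by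
      ext a
      simp only [Set.mem_ofPred_eq, Set.mem_iInter, ← map_sub]
      constructor
      · intro h x'
        calc ‖x' (W a - d i)‖ ≤ ‖x'‖ * ‖W a - d i‖ := x'.le_opNorm _
          _ ≤ ‖x'‖ * (ε / 3) := by gcongr
          _ = _ := mul_comm _ _
      · intro h
        exact NormedSpace.norm_le_dual_bound ℝ _ (by positivity) h
    rw [he]
    exact isClosed_iInter fun x' => isClosed_le (((hWc x').sub continuous_const).norm)
      continuous_const
  have hcover : (⋃ i, {a | ‖W a - d i‖ ≤ ε / 3}) = Set.univ := by
    refine Set.eq_univ_of_forall fun a => ?_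
    obtain ⟨y, hy, hya⟩ := Metric.mem_closure_iff.1 (hD (hmem {n | a n = true})) (ε / 3)
      (by positivity)
    rw [hd] at hy
    obtain ⟨i, rfl⟩ := hy
    refine Set.mem_iUnion.2 ⟨i, ?_⟩
    rw [dist_eq_norm] at hya
    exact hya.le
  -- By Baire, one ball of radius `ε / 3` contains the image under `W` of a whole cylinder, which
  -- constrains only the coordinates in `s`.
  obtain ⟨i, a, ha⟩ := nonempty_interior_of_iUnion_of_closed hclosed hcover
  obtain ⟨s, u, hu, hsub⟩ := (isOpen_pi_iff.1 isOpen_interior) a ha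
  refine ⟨s, fun t ht => ?_⟩
  -- Switching the coordinates in `t` on or off stays in the cylinder, and the two values of `W`
  -- differ by the sum over `t`.
  let b : Bool → ℕ → Bool := fun c n => if n ∈ t then c else a n
  have hb : ∀ c, ‖W (b c) - d i‖ ≤ ε / 3 := by
    intro c
    refine interior_subset (s := {a | ‖W a - d i‖ ≤ ε / 3}) (hsub ?_)
    intro n hn
    have : n ∉ t := fun h => Finset.disjoint_left.1 ht h hn
    simpa [b, this] using (hu n hn).2
  have hdiff : W (b true) - W (b false) = ∑ n ∈ t, v n := by
    refine (SeparatingDual.eq_iff_forall_dual_eq (R := ℝ)).2 fun x' => ?_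
    rw [map_sub, hw, hw, ← ((hs x').indicator _).tsum_sub ((hs x').indicator _), map_sum,
      tsum_eq_sum (s := t)]
    · refine Finset.sum_congr rfl fun n hn => ?_
      simp [b, hn]
    · intro n hn
      simp [Set.indicator_apply, b, hn]
  rw [← hdiff]
  calc ‖W (b true) - W (b false)‖ = ‖(W (b true) - d i) - (W (b false) - d i)‖ := by
        rw [sub_sub_sub_cancel_right]
    _ ≤ ‖W (b true) - d i‖ + ‖W (b false) - d i‖ := norm_sub_le _ _
    _ ≤ ε / 3 + ε / 3 := add_le_add (hb _) (hb _)
    _ < ε := by linarith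

theorem weakly_subseries_summable_of_summable [CompleteSpace E] {v : ℕ → E} (hv : Summable v) :
    (∀ x' : StrongDual ℝ E, Summable fun n => x' (v n)) ∧
    ∀ A : Set ℕ, ∃ xA : E, ∀ x' : StrongDual ℝ E,
      x' xA = ∑' n, A.indicator (fun n => x' (v n)) n := by
  refine ⟨fun x' => hv.mapL x', fun A => ⟨∑' n, A.indicator v n, fun x' => ?_⟩⟩
  rw [x'.map_tsum (hv.indicator A)]
  refine tsum_congr fun n => ?_
  by_cases hn : n ∈ A <;> simp [hn]

/-- Multiplying by coefficients in `[0, 1]` does not increase the supremum of the norms of the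
partial sums. -/
theorem norm_add_sum_smul_le {ι : Type*} (M : Finset ι) (c : ι → ℝ) (v : ι → E) {B : ℝ}
    (hc : ∀ j ∈ M, 0 ≤ c j ∧ c j ≤ 1) (w : E) (h : ∀ N ⊆ M, ‖w + ∑ j ∈ N, v j‖ ≤ B) :
    ‖w + ∑ j ∈ M, c j • v j‖ ≤ B := by
  classical
  induction M using Finset.induction_on generalizing w with
  | empty => simpa using h ∅ le_rfl
  | insert a M ha ih =>
    have hc' : ∀ j ∈ M, 0 ≤ c j ∧ c j ≤ 1 := fun j hj => hc j (Finset.mem_insert_of_mem hj)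
    obtain ⟨h0, h1⟩ := hc a (Finset.mem_insert_self a M)
    have i1 := ih hc' w fun N hN => h N (hN.trans (Finset.subset_insert a M))
    have i2 := ih hc' (w + v a) fun N hN => by
      have := h (insert a N) (Finset.insert_subset_insert a hN)
      rwa [Finset.sum_insert (fun h => ha (hN h)), ← add_assoc] at this
    -- The sum is affine in `c a`, hence a convex combination of its values at 0 and 1; at 1 the
    -- offset `w` absorbs `v a`.
    have he : w + ∑ j ∈ insert a M, c j • v j =
        (1 - c a) • (w + ∑ j ∈ M, c j • v j) + c a • (w + v a + ∑ j ∈ M, c j • v j) := by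
      rw [Finset.sum_insert ha]
      module
    rw [he]
    calc _ ≤ (1 - c a) * ‖w + ∑ j ∈ M, c j • v j‖ + c a * ‖w + v a + ∑ j ∈ M, c j • v j‖ := by
          refine (norm_add_le _ _).trans_eq ?_
          rw [norm_smul, norm_smul, Real.norm_of_nonneg h0, Real.norm_of_nonneg (by linarith)]
      _ ≤ (1 - c a) * B + c a * B := by
          have : 0 ≤ 1 - c a := by linarith
          gcongr
      _ = B := by ring

theorem norm_sum_smul_le_of_le {ι : Type*} (M : Finset ι) {g h : ι → ℝ} (v : ι → E) {B : ℝ}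
    (hg : ∀ j ∈ M, 0 ≤ g j) (hgh : ∀ j ∈ M, g j ≤ h j)
    (hB : ∀ N ⊆ M, ‖∑ j ∈ N, h j • v j‖ ≤ B) : ‖∑ j ∈ M, g j • v j‖ ≤ B := by
  have := norm_add_sum_smul_le M (fun j => g j / h j) (fun j => h j • v j) (B := B)
    (fun j hj => ⟨div_nonneg (hg j hj) ((hg j hj).trans (hgh j hj)),
      div_le_one_of_le₀ (hgh j hj) ((hg j hj).trans (hgh j hj))⟩) 0
    (fun N hN => by simpa using hB N hN)
  rw [zero_add] at this
  convert this using 2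
  refine Finset.sum_congr rfl fun j hj => ?_
  rw [smul_smul]
  -- Where `h j = 0` the quotient `g j / h j` is 0 by convention, and `g j = 0` as well.
  rcases eq_or_ne (h j) 0 with h0 | h0
  · rw [h0, mul_zero, le_antisymm (h0 ▸ hgh j hj) (hg j hj)]
  · rw [div_mul_cancel₀ _ h0]

theorem Summable.exists_norm_finset_sum_le {F : Type*} [NormedAddCommGroup F]
    {ι : Type*} {v : ι → F} (hv : Summable v) :
    ∃ B, ∀ s : Finset ι, ‖∑ i ∈ s, v i‖ ≤ B := by
  classical
  obtain ⟨s, hs⟩ := (cauchySeq_finset_iff_vanishing_norm.1 hv.hasSum.cauchySeq) 1 one_pos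
  refine ⟨1 + ∑ i ∈ s, ‖v i‖, fun t => ?_⟩
  rw [← Finset.sum_inter_add_sum_sdiff t s, add_comm]
  refine (norm_add_le _ _).trans (add_le_add (hs _ Finset.sdiff_disjoint).le ?_)
  exact (norm_sum_le _ _).trans
    (Finset.sum_le_sum_of_subset_of_nonneg Finset.inter_subset_right fun _ _ _ => norm_nonneg _)

/-- By completeness subfamilies stay summable, so the terms can be split by the sign of `f`. -/
theorem Summable.abs_smul [CompleteSpace E] {ι : Type*} {f : ι → ℝ} {v : ι → E}
    (h : Summable fun i => f i • v i) : Summable fun i => |f i| • v i := by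
  have h2 := (h.indicator {i | 0 ≤ f i}).sub (h.indicator {i | 0 ≤ f i}ᶜ)
  refine h2.congr fun i => ?_
  by_cases hi : 0 ≤ f i
  · simp [hi, abs_of_nonneg hi]
  · simp [hi, abs_of_neg (not_le.1 hi)]

/-- A series `∑ 2⁻ᵏ yₖ` of finitely supported nonnegative sequences whose partial sums against `v`
are bounded by `1` is summable against `v`. -/
theorem summable_tsum_half_pow_smul [CompleteSpace E] {v : ℕ → E} (y : ℕ → ℕ → ℝ)
    (hfin : ∀ k, (Function.support (y k)).Finite)
    (hsum : ∀ n, Summable fun k => (1 / 2 : ℝ) ^ k * y k n)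
    (hb : ∀ k (N : Finset ℕ), ‖∑ n ∈ N, y k n • v n‖ ≤ 1) :
    Summable fun n => (∑' k, (1 / 2 : ℝ) ^ k * y k n) • v n := by
  classical
  rw [summable_iff_vanishing_norm]
  intro ε hε
  have hgeom : Summable fun k : ℕ => (1 / 2 : ℝ) ^ k := summable_geometric_two
  obtain ⟨K, hK⟩ := ((tendsto_order.1 (tendsto_sum_nat_add fun k : ℕ => (1 / 2 : ℝ) ^ k)).2 ε
    hε).exists
  -- Off the supports of the first `K` sequences only the tail of the geometric series contributes.
  refine ⟨(Finset.range K).biUnion fun k => (hfin k).toFinset, fun t ht => ?_⟩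
  have hz : ∀ k < K, ∀ n ∈ t, y k n = 0 := by
    intro k hk n hn
    by_contra h
    refine Finset.disjoint_left.1 ht hn (Finset.mem_biUnion.2 ⟨k, Finset.mem_range.2 hk, ?_⟩)
    simpa using h
  have hterm : HasSum (fun k => ∑ n ∈ t, ((1 / 2 : ℝ) ^ k * y k n) • v n)
      (∑ n ∈ t, (∑' k, (1 / 2 : ℝ) ^ k * y k n) • v n) :=
    hasSum_sum fun n _ => (hsum n).hasSum.smul_const (v n)
  have hle : ∀ k, ‖∑ n ∈ t, ((1 / 2 : ℝ) ^ k * y k n) • v n‖ ≤ (1 / 2 : ℝ) ^ k := by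
    intro k
    simp_rw [mul_smul]
    rw [← Finset.smul_sum, norm_smul, Real.norm_of_nonneg (by positivity)]
    exact mul_le_of_le_one_right (by positivity) (hb k t)
  rw [← hterm.tsum_eq, ← hterm.summable.sum_add_tsum_nat_add K, Finset.sum_eq_zero, zero_add]
  · exact (tsum_of_norm_bounded ((summable_nat_add_iff K).2 hgeom).hasSum
      fun k => hle (k + K)).trans_lt hK
  · intro k hk
    refine Finset.sum_eq_zero fun n hn => ?_
    rw [hz k (Finset.mem_range.1 hk) n hn, mul_zero, zero_smul]

end BanachSpace

/-! ### Power domination and the inclusion of the sequence spaces. -/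

theorem mem_L1_opMeasure_iff_summable {E : Type*} [NormedAddCommGroup E] [NormedSpace ℝ E]
    [CompleteSpace E] (T : SeqL1 →L[ℝ] E) (f : ℕ → ℝ) :
    f ∈ (opMeasure T).L1 ↔ Summable fun n => f n • T (unitVec n) := by
  rw [mem_L1_opMeasure_iff]
  exact ⟨fun h => summable_of_weakly_subseries_summable h.1 h.2,
    fun h => weakly_subseries_summable_of_summable h⟩

theorem IsPowerDominated.summable_rpow {E : Type*} [NormedAddCommGroup E] [NormedSpace ℝ E]
    [CompleteSpace E] {T : SeqL1 →L[ℝ] E} {r : ℝ} (hr : 0 < r) (h : IsPowerDominated T r)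
    {f : ℕ → ℝ} (hf : Summable fun n => f n • T (unitVec n)) :
    Summable fun n => |f n| ^ r • T (unitVec n) := by
  obtain ⟨C, hC, h⟩ := h
  rw [summable_iff_vanishing_norm]
  intro ε hε
  have hδ : 0 < ε ^ (1 / r) / C := by positivity
  obtain ⟨s, hs⟩ := summable_iff_vanishing_norm.1 hf.abs_smul _ hδ
  refine ⟨s, fun t ht => ?_⟩
  have h1 := h t (fun n => |f n|) (fun _ _ => abs_nonneg _)
  have h2 : t.powerset.sup' (Finset.powerset_nonempty t)
      (fun N => ‖∑ j ∈ N, |f j| • T (unitVec j)‖) < ε ^ (1 / r) / C :=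
    -- The supremum is harmless: subsets of `t` are disjoint from `s` too.
    (Finset.sup'_lt_iff _).2 fun N hN => hs N (ht.mono_left (Finset.mem_powerset.1 hN))
  have h3 := h1.trans_lt (mul_lt_mul_of_pos_left h2 hC)
  rw [mul_div_cancel₀ _ hC.ne'] at h3
  exact (Real.rpow_lt_rpow_iff (norm_nonneg _) hε.le (by positivity)).1 h3

theorem exists_normalized_of_not_isPowerDominated {E : Type*} [NormedAddCommGroup E]
    [NormedSpace ℝ E] {T : SeqL1 →L[ℝ] E} (hT : ∀ n : ℕ, T (unitVec n) ≠ 0) {r : ℝ} (hr : 0 < r)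
    (h : ¬ IsPowerDominated T r) {C : ℝ} (hC : 0 < C) :
    ∃ (M : Finset ℕ) (y : ℕ → ℝ), (∀ n, 0 ≤ y n) ∧ (∀ n ∉ M, y n = 0) ∧
      (∀ N : Finset ℕ, ‖∑ n ∈ N, y n • T (unitVec n)‖ ≤ 1) ∧
      C ^ r < ‖∑ n ∈ M, y n ^ r • T (unitVec n)‖ := by
  classical
  unfold IsPowerDominated at h
  push Not at h
  obtain ⟨M, x, hx, hlt⟩ := h C hC
  set S := M.powerset.sup' (Finset.powerset_nonempty M)
    (fun N => ‖∑ j ∈ N, x j • T (unitVec j)‖) with hS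
  have hle : ∀ N ⊆ M, ‖∑ j ∈ N, x j • T (unitVec j)‖ ≤ S := fun N hN =>
    Finset.le_sup' (fun N => ‖∑ j ∈ N, x j • T (unitVec j)‖) (Finset.mem_powerset.2 hN)
  have hS0 : 0 ≤ S := (norm_nonneg _).trans (hle ∅ (Finset.empty_subset M))
  -- If `S = 0`, singletons and `T e_j ≠ 0` force `x = 0` on `M`; both sides of the strict
  -- inequality would then vanish.
  have hSpos : 0 < S := by
    refine hS0.lt_of_ne fun h0 => ?_
    have hx0 : ∀ j ∈ M, x j = 0 := by
      intro j hj
      have := hle {j} (Finset.singleton_subset_iff.2 hj)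
      rw [← h0, Finset.sum_singleton, norm_le_zero_iff, smul_eq_zero] at this
      exact this.resolve_right (hT j)
    have hz : ∑ j ∈ M, x j ^ r • T (unitVec j) = 0 :=
      Finset.sum_eq_zero fun j hj => by rw [hx0 j hj, Real.zero_rpow hr.ne', zero_smul]
    rw [hz, ← h0, norm_zero, Real.zero_rpow (one_div_pos.2 hr).ne', mul_zero] at hlt
    exact lt_irrefl _ hlt
  refine ⟨M, fun n => if n ∈ M then x n / S else 0, fun n => ?_, fun n hn => if_neg hn,
    fun N => ?_, ?_⟩
  · dsimp only
    split_ifs with hn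
    · exact div_nonneg (hx n hn) hS0
    · exact le_rfl
  · have he : ∑ n ∈ N, (if n ∈ M then x n / S else 0) • T (unitVec n) =
        S⁻¹ • ∑ n ∈ N ∩ M, x n • T (unitVec n) := by
      rw [← Finset.filter_mem_eq_inter, Finset.sum_filter, Finset.smul_sum]
      refine Finset.sum_congr rfl fun n _ => ?_
      split_ifs
      · rw [smul_smul, div_eq_inv_mul]
      · simp
    rw [he, norm_smul, norm_inv, Real.norm_of_nonneg hS0, inv_mul_le_one₀ hSpos]
    exact hle _ Finset.inter_subset_right
  · have he : ∑ n ∈ M, (if n ∈ M then x n / S else 0) ^ r • T (unitVec n) =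
        (S ^ r)⁻¹ • ∑ n ∈ M, x n ^ r • T (unitVec n) := by
      rw [Finset.smul_sum]
      refine Finset.sum_congr rfl fun n hn => ?_
      rw [if_pos hn, smul_smul, Real.div_rpow (hx n hn) hS0, div_eq_inv_mul]
    have hSr : 0 < S ^ r := by positivity
    rw [he, norm_smul, norm_inv, Real.norm_of_nonneg hSr.le, lt_inv_mul_iff₀ hSr, mul_comm,
      ← Real.mul_rpow hC.le hS0]
    have := Real.rpow_lt_rpow (by positivity) hlt hr
    rwa [← Real.rpow_mul (norm_nonneg _), one_div_mul_cancel hr.ne', Real.rpow_one] at this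

theorem isPowerDominated_of_forall_summable {E : Type*} [NormedAddCommGroup E]
    [NormedSpace ℝ E] [CompleteSpace E] {T : SeqL1 →L[ℝ] E} (hT : ∀ n : ℕ, T (unitVec n) ≠ 0)
    {r : ℝ} (hr : 0 < r)
    (h : ∀ f : ℕ → ℝ, (Summable fun n => f n • T (unitVec n)) →
      Summable fun n => |f n| ^ r • T (unitVec n)) : IsPowerDominated T r := by
  by_contra hnot
  -- The growth `4 ^ k` beats the weight `2⁻ᵏ`, leaving `2 ^ k` before taking the power `r`.
  choose M y hy0 hyM hy1 hyC using fun k : ℕ =>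
    exists_normalized_of_not_isPowerDominated hT hr hnot (C := 4 ^ k) (by positivity)
  -- Since `T e_n ≠ 0`, the singleton bound gives `y k n ≤ ‖T e_n‖⁻¹` uniformly in `k`.
  have hsum : ∀ n, Summable fun k => (1 / 2 : ℝ) ^ k * y k n := by
    intro n
    refine Summable.of_nonneg_of_le (fun k => mul_nonneg (by positivity) (hy0 k n)) (fun k => ?_)
      (summable_geometric_two.mul_right ‖T (unitVec n)‖⁻¹)
    refine mul_le_mul_of_nonneg_left ?_ (by positivity)
    have := hy1 k {n}
    rw [Finset.sum_singleton, norm_smul, Real.norm_of_nonneg (hy0 k n)] at this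
    rw [← one_div]
    exact (le_div_iff₀ (norm_pos_iff.2 (hT n))).2 this
  have hf := h _ (summable_tsum_half_pow_smul y (v := fun n => T (unitVec n))
    (fun k => (M k).finite_toSet.subset fun n hn => by
      by_contra hnM
      exact hn (hyM k n hnM)) hsum hy1)
  obtain ⟨B, hB⟩ := hf.exists_norm_finset_sum_le
  have hbound : ∀ k : ℕ, ((2 : ℝ) ^ r) ^ k ≤ B := by
    intro k
    -- A single term of the nonnegative series defining `f` is at most `f`, so the bound `B` for
    -- `|f| ^ r` passes to it.
    have h1 : ‖∑ n ∈ M k, ((1 / 2 : ℝ) ^ k * y k n) ^ r • T (unitVec n)‖ ≤ B := by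
      refine norm_sum_smul_le_of_le (M k) _
        (fun n _ => Real.rpow_nonneg (mul_nonneg (by positivity) (hy0 k n)) r) (fun n _ => ?_)
        (fun N _ => hB N)
      refine Real.rpow_le_rpow (mul_nonneg (by positivity) (hy0 k n)) ?_ hr.le
      exact ((hsum n).le_tsum k fun j _ => mul_nonneg (by positivity) (hy0 j n)).trans
        (le_abs_self _)
    have h2 : ∑ n ∈ M k, ((1 / 2 : ℝ) ^ k * y k n) ^ r • T (unitVec n) =
        ((1 / 2 : ℝ) ^ k) ^ r • ∑ n ∈ M k, y k n ^ r • T (unitVec n) := by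
      rw [Finset.smul_sum]
      refine Finset.sum_congr rfl fun n _ => ?_
      rw [smul_smul, Real.mul_rpow (by positivity) (hy0 k n)]
    rw [h2, norm_smul, Real.norm_of_nonneg (by positivity)] at h1
    refine le_trans (le_of_eq ?_) ((mul_le_mul_of_nonneg_left (hyC k).le (by positivity)).trans h1)
    rw [← Real.mul_rpow (by positivity) (by positivity), ← mul_pow, Real.rpow_pow_comm (by norm_num)]
    norm_num
  obtain ⟨k, hk⟩ := pow_unbounded_of_one_lt B (Real.one_lt_rpow one_lt_two hr)
  exact absurd (hbound k) (not_le.2 hk)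

theorem mainTheorem8 {E : Type*} [NormedAddCommGroup E] [NormedSpace ℝ E] [CompleteSpace E]
    (T : SeqL1 →L[ℝ] E) (hT : ∀ n : ℕ, T (unitVec n) ≠ 0) (r : ℝ) (hr : 0 < r) :
    (opMeasure T).L1 ⊆ (opMeasure T).Lpow r ↔ IsPowerDominated T r := by
  constructor
  · intro h
    exact isPowerDominated_of_forall_summable hT hr fun f hf =>
      (mem_L1_opMeasure_iff_summable T _).1 (h ((mem_L1_opMeasure_iff_summable T f).2 hf)).2
  · intro h f hf
    exact ⟨DeltaRing.measurable_finiteSets_loc f, (mem_L1_opMeasure_iff_summable T _).2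
      (h.summable_rpow hr ((mem_L1_opMeasure_iff_summable T f).1 hf))⟩
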